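/- Let $n\ge 1$, let $k\ge 2$ be an integer, and let $\varphi:(0,+\infty)\to(0,+\infty)$ be a function of class $\mathcal C^k$ such that (a) $\varphi^{(j)}$ extends continuously to $0$ for $0\le j\le k$ (the extended values are denoted by $\varphi^{(j)}(0)$); (b) $\lim_{x\to0^+}(\varphi^{(j-1)}(x)-\varphi^{(j-1)}(0))/x=\varphi^{(j)}(0)$ for $1\le j\le k$; (c) $\varphi^{(j)}(0)=0$ for $0\le j\le s$, for some $s$ with $1\le s\le k$; (d) $\varphi$ is strictly increasing and convex; (e) $\varphi(a)=1$ for some $a>0$, and $\Omega_\varphi:=\{z\in\mathbb C^n:\varphi(|z_1|^2)+\sum_{2\le j\le n}|z_j|^2<1\}$ is a convex domain with $\mathcal C^k$-smooth boundary. Then $\Omega_\varphi$ is $B$-regular, i.e., it is a bounded domain such that every continuous function $\partial\Omega_\varphi\to\mathbb R$ is the uniform limit on $\partial\Omega_\varphi$ of a sequence of continuous plurisubharmonic functions, each defined on some open neighbourhood of $\partial\Omega_\varphi$. For a domain $\Omega\subsetneq\mathbb C^n$, $z\in\Omega$, $u\in\mathbb C^n$ with $\|u\|=1$, and $v\in\mathbb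 C^n$, write $\delta_\Omega(z)$ for the Euclidean distance of $z$ to $\partial\Omega$, $r_\Omega(z;u):=\sup\{r>0: z+(r\mathbb D)u\subset\Omega\}$, where $\mathbb D$ is the open unit disc in $\mathbb C$, and $k_\Omega(z;v):=\inf\{|\alpha|: f:\mathbb D\to\Omega \text{ holomorphic},\ f(0)=z,\ \alpha f'(0)=v\}$ for the Kobayashi metric. Fix $l\in\{2,\dots,n\}$, let $\varepsilon\in(-1,-1/2)$, let $z_\varepsilon$ be the point whose $l$-th coordinate is $\varepsilon$ and whose other coordinates are $0$, let $\boldsymbol\epsilon_1:=(1,0,\dots,0)$, and write $\eta_\varepsilon:=\big(\varphi^{-1}(\delta_{\Omega_\varphi}(z_\varepsilon))\big)^{1/2}$. For a constant $C>0$ consider the estimates (i) $\eta_\varepsilon\le r_{\Omega_\varphi}(z_\varepsilon;\boldsymbol\epsilon_1)\le C\,\eta_\varepsilon$; (ii) $\displaystyle \frac{\|v\|}{2C\,\eta_\varepsilon}\le k_{\Omega_\varphi}(z_\varepsilon;v)\le\frac{\|v\|}{\eta_\varepsilon}$ for all $v\in\mathrm{span}_{\mathbb C}\{\boldsymbol\epsilon_1\}$.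 Then: (1) if $a\ge 1/4$ or $1+\varepsilon\le a$ (thus for every $\varepsilon\in(-1,-1/2)$ if $a\ge1/4$, and for every $\varepsilon$ sufficiently close to $-1$ in all cases), (i) and (ii) hold with $C=2$; (2) for every $a>0$ and every $\varepsilon\in(-1,-1/2)$, (i) and (ii) hold with $C=C_\varphi:=\max\{2,(a/\varphi^{-1}(a))^{1/2}\}$, which depends only on $\varphi$. -/

import Mathlib

open Set Filter Topology

noncomputable section

/-- `ℂⁿ` with its Euclidean norm, `n = m + 1`; the coordinate `z₁` is `z 0` and
`z₂, …, zₙ` are the `z j.succ` with `j : Fin m`. -/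
abbrev CSpace (m : ℕ) : Type := EuclideanSpace ℂ (Fin (m + 1))

/-- The domain `Ω_φ = {z ∈ ℂⁿ : φ(|z₁|²) + ∑_{2 ≤ j ≤ n} |z_j|² < 1}`. -/
def OmegaPhi (φ : ℝ → ℝ) (m : ℕ) : Set (CSpace m) :=
  {z | φ (‖z 0‖ ^ 2) + ∑ j : Fin m, ‖z j.succ‖ ^ 2 < 1}

/-- `Ω` has `𝒞ᵏ`-smooth boundary: near each boundary point, `Ω` is the negativity set of a
`𝒞ᵏ` function without critical points. -/
def HasCkBoundary {m : ℕ} (k : ℕ) (Ω : Set (CSpace m)) : Prop :=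
  ∀ p ∈ frontier Ω, ∃ (U : Set (CSpace m)) (ρ : CSpace m → ℝ),
    IsOpen U ∧ p ∈ U ∧ ContDiffOn ℝ k ρ U ∧ (∀ z ∈ U, fderiv ℝ ρ z ≠ 0) ∧
      Ω ∩ U = {z ∈ U | ρ z < 0}

/-- `u` is a continuous (real-valued) plurisubharmonic function on the open set `U`: it is
continuous and satisfies the sub-mean value inequality on every closed affine complex disc
contained in `U`. -/
structure IsContPSHOn {m : ℕ} (u : CSpace m → ℝ) (U : Set (CSpace m)) : Prop where
  isOpen : IsOpen U
  continuousOn : ContinuousOn u U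
  submean : ∀ z v : CSpace m, (∀ lam : ℂ, ‖lam‖ ≤ 1 → z + lam • v ∈ U) →
    u z ≤ Real.circleAverage (fun lam : ℂ => u (z + lam • v)) 0 1

/-- `Ω` is a (bounded) `B`-regular domain: every continuous function on `∂Ω` is the uniform limit
on `∂Ω` of a sequence of continuous plurisubharmonic functions, each of which is defined on some
open neighbourhood of `∂Ω`. -/
structure IsBRegularDomain {m : ℕ} (Ω : Set (CSpace m)) : Prop where
  isOpen : IsOpen Ω
  isConnected : IsConnected Ω
  isBounded : Bornology.IsBounded Ω
  approx : ∀ g : CSpace m → ℝ, ContinuousOn g (frontier Ω) →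
    ∃ (U : ℕ → Set (CSpace m)) (u : ℕ → CSpace m → ℝ),
      (∀ ν, frontier Ω ⊆ U ν ∧ IsContPSHOn (u ν) (U ν)) ∧
        TendstoUniformlyOn u g atTop (frontier Ω)

/-- `δ_Ω(z)`, the Euclidean distance of `z` to `∂Ω`. -/
def bdryDist {m : ℕ} (Ω : Set (CSpace m)) (z : CSpace m) : ℝ :=
  Metric.infDist z (frontier Ω)

/-- `r_Ω(z; v) = sup {r > 0 : z + (r𝔻)v ⊆ Ω}`. -/
def discRadius {m : ℕ} (Ω : Set (CSpace m)) (z v : CSpace m) : ℝ :=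
  sSup {r : ℝ | 0 < r ∧ ∀ lam : ℂ, ‖lam‖ < 1 → z + ((r : ℂ) * lam) • v ∈ Ω}

/-- The Kobayashi (pseudo)metric
`k_Ω(z; v) = inf {|α| : f ∈ 𝒪(𝔻; Ω), f(0) = z, α f'(0) = v}`, for `z ∈ Ω`. -/
def kobayashiMetric {m : ℕ} (Ω : Set (CSpace m)) (z v : CSpace m) : ℝ :=
  sInf {t : ℝ | ∃ (α : ℂ) (f : ℂ → CSpace m), ‖α‖ = t ∧
    DifferentiableOn ℂ f (Metric.ball 0 1) ∧ MapsTo f (Metric.ball 0 1) Ω ∧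
      f 0 = z ∧ α • deriv f 0 = v}

/-- The inverse of `φ : (0, ∞) → (0, ∞)`. -/
def phiInv (φ : ℝ → ℝ) : ℝ → ℝ := Function.invFunOn φ (Ioi 0)

/-- The hypotheses on `φ` (and on the exponents `k`, `s`, the number `a` and the dimension
`n = m + 1`). Here `D j` is the value `φ⁽ʲ⁾(0)` of the continuous extension of `φ⁽ʲ⁾` to `0`; the
function `φ` is considered on `[0, ∞)`, with `φ(0) = D 0`. -/
structure IsProfile (φ : ℝ → ℝ) (D : ℕ → ℝ) (k s m : ℕ) (a : ℝ) : Prop where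
  two_le : 2 ≤ k
  pos : ∀ x, 0 < x → 0 < φ x
  contDiffOn : ContDiffOn ℝ k φ (Ioi 0)
  at_zero : φ 0 = D 0
  extends_zero : ∀ j ≤ k, Tendsto (iteratedDeriv j φ) (𝓝[>] 0) (𝓝 (D j))
  diffQuot : ∀ j, 1 ≤ j → j ≤ k →
    Tendsto (fun x : ℝ => (iteratedDeriv (j - 1) φ x - D (j - 1)) / x) (𝓝[>] 0) (𝓝 (D j))
  one_le_s : 1 ≤ s
  s_le : s ≤ k
  flat : ∀ j ≤ s, D j = 0
  strictMonoOn : StrictMonoOn φ (Ioi 0)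
  convexOn : ConvexOn ℝ (Ioi 0) φ
  a_pos : 0 < a
  phi_a : φ a = 1
  isOpen : IsOpen (OmegaPhi φ m)
  isConnected : IsConnected (OmegaPhi φ m)
  convex : Convex ℝ (OmegaPhi φ m)
  smooth : HasCkBoundary k (OmegaPhi φ m)

/-- The point `z_ε = (0, …, 0, ε, 0, …, 0)` on the axis of the coordinate `z_l`, `2 ≤ l ≤ n`. -/
def zPoint {m : ℕ} (l : Fin m) (ε : ℝ) : CSpace m := EuclideanSpace.single l.succ (ε : ℂ)

/-- The vector `(1, 0, …, 0)`. -/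
def eOne (m : ℕ) : CSpace m := EuclideanSpace.single 0 1

/-- `(φ⁻¹(δ_{Ω_φ}(z_ε)))^{1/2}`. -/
def sqrtInvDelta (φ : ℝ → ℝ) {m : ℕ} (l : Fin m) (ε : ℝ) : ℝ :=
  Real.sqrt (phiInv φ (bdryDist (OmegaPhi φ m) (zPoint l ε)))

/-- The two-sided estimates of the disc radius and of the Kobayashi metric of `Ω_φ` at `z_ε`,
with constants `C` and `2 C`. -/
def AxisEstimates (φ : ℝ → ℝ) {m : ℕ} (l : Fin m) (ε C : ℝ) : Prop :=
  (sqrtInvDelta φ l ε ≤ discRadius (OmegaPhi φ m) (zPoint l ε) (eOne m) ∧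
    discRadius (OmegaPhi φ m) (zPoint l ε) (eOne m) ≤ C * sqrtInvDelta φ l ε) ∧
  ∀ v ∈ Submodule.span ℂ {eOne m},
    ‖v‖ / (2 * C * sqrtInvDelta φ l ε) ≤ kobayashiMetric (OmegaPhi φ m) (zPoint l ε) v ∧
    kobayashiMetric (OmegaPhi φ m) (zPoint l ε) v ≤ ‖v‖ / sqrtInvDelta φ l ε

end

/-! For B-regularity, convex functions suffice, since they are plurisubharmonic. The defining
function degenerates in the `z₁` direction where `z₁ = 0`, but a large multiple of it, corrected
where `|z₁|² ≤ δ`, gives a weight `w` with `w - ‖·‖²` convex and `|w| ≤ δ` on the boundary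
(`exists_weight`). A sup-convolution of boundary data becomes convex after adding `N‖·‖²`; replacing
that term by `N w` costs little on the boundary (`exists_convexOn_approx`).

For the estimates, write `d` for the boundary distance of `z_ε`. The slice of `Ω_φ` through `z_ε`
along `z₁` is a disc of radius `R = φ⁻¹(1 - ε²)^{1/2}`, and `d ≤ 1 + ε ≤ 1 - ε²` gives `η ≤ R`. A
separating hyperplane at its rim and Borel–Carathéodory bound derivatives of holomorphic discs by
`2R`. What remains is `φ⁻¹(1 - ε²) ≤ C² φ⁻¹(d)` (`axisEstimates_of_phiInv_le`). By convexity
`φ⁻¹(4d) ≤ 4 φ⁻¹(d)` within range, so `1 - ε² ≤ 4d` yields `C = 2`; if `1 + ε ≥ a`, then `d ≥ a`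
yields the general constant. Lower bounds on `d` come from the chord bound `φ(x) ≤ x / a`. -/

namespace IsProfile

variable {φ : ℝ → ℝ} {D : ℕ → ℝ} {k s m : ℕ} {a : ℝ}

/-! ### The profile on `[0, ∞)` and its inverse. -/

lemma map_zero (h : IsProfile φ D k s m a) : φ 0 = 0 :=
  h.at_zero.trans (h.flat 0 (Nat.zero_le _))

lemma continuousOn_Ici (h : IsProfile φ D k s m a) : ContinuousOn φ (Ici 0) := by
  intro x hx
  rcases eq_or_lt_of_le (mem_Ici.1 hx) with rfl | hx
  · rw [← continuousWithinAt_Ioi_iff_Ici]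
    have := h.extends_zero 0 (Nat.zero_le _)
    rw [iteratedDeriv_zero, ← h.at_zero] at this
    exact this
  · exact (h.contDiffOn.continuousOn.continuousAt (Ioi_mem_nhds hx)).continuousWithinAt

lemma strictMonoOn_Ici (h : IsProfile φ D k s m a) : StrictMonoOn φ (Ici 0) := by
  intro x hx y _ hxy
  rcases eq_or_lt_of_le (mem_Ici.1 hx) with rfl | hx
  · rw [h.map_zero]
    exact h.pos y hxy
  · exact h.strictMonoOn hx (hx.trans hxy) hxy

lemma convexOn_Ici (h : IsProfile φ D k s m a) : ConvexOn ℝ (Ici 0) φ := by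
  refine ⟨convex_Ici 0, fun x hx y hy b c hb hc hbc => ?_⟩
  rw [mem_Ici] at hx hy
  -- Convexity on the open half-line passes to the closed one by translating by `t > 0` and letting
  -- `t → 0`.
  have key : ∀ w : ℝ, 0 ≤ w → Tendsto (fun t : ℝ => φ (w + t)) (𝓝[>] 0) (𝓝 (φ w)) := by
    intro w hw
    refine (h.continuousOn_Ici w hw).tendsto.comp (tendsto_nhdsWithin_iff.2 ⟨?_, ?_⟩)
    · have : Tendsto (fun t : ℝ => w + t) (𝓝 0) (𝓝 (w + 0)) :=
        tendsto_const_nhds.add tendsto_id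
      rw [add_zero] at this
      exact this.mono_left nhdsWithin_le_nhds
    · filter_upwards [self_mem_nhdsWithin] with t ht
      exact add_nonneg hw (le_of_lt ht)
  have hw : 0 ≤ b • x + c • y := by simp only [smul_eq_mul]; positivity
  refine le_of_tendsto_of_tendsto (key _ hw) (((key x hx).const_smul b).add
    ((key y hy).const_smul c)) ?_
  filter_upwards [self_mem_nhdsWithin] with t ht
  have ht : 0 < t := ht
  have := h.convexOn.2 (show x + t ∈ Ioi 0 from mem_Ioi.2 (by linarith))
    (show y + t ∈ Ioi 0 from mem_Ioi.2 (by linarith)) hb hc hbc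
  have e : b • x + c • y + t = b • (x + t) + c • (y + t) := by
    simp only [smul_eq_mul]; linear_combination -t * hbc
  rwa [e]

lemma map_mul_le (h : IsProfile φ D k s m a) {c x : ℝ} (hc : 0 ≤ c) (hc1 : c ≤ 1) (hx : 0 ≤ x) :
    φ (c * x) ≤ c * φ x := by
  have := h.convexOn_Ici.2 (mem_Ici.2 hx) (mem_Ici.2 le_rfl) hc (sub_nonneg.2 hc1) (by ring)
  simpa [h.map_zero] using this

lemma map_nonneg (h : IsProfile φ D k s m a) {x : ℝ} (hx : 0 ≤ x) : 0 ≤ φ x := by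
  rw [← h.map_zero]
  exact h.strictMonoOn_Ici.monotoneOn (mem_Ici.2 le_rfl) (mem_Ici.2 hx) hx

lemma le_a (h : IsProfile φ D k s m a) {x : ℝ} (hx : 0 ≤ x) (h1 : φ x ≤ 1) : x ≤ a := by
  rw [← h.phi_a] at h1
  exact (h.strictMonoOn_Ici.le_iff_le hx h.a_pos.le).1 h1

/-- The graph lies below the chord from `(0, 0)` to `(a, 1)`. -/
lemma mul_map_le (h : IsProfile φ D k s m a) {x : ℝ} (hx : 0 ≤ x) (h1 : φ x ≤ 1) :
    a * φ x ≤ x := by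
  have ha := h.a_pos
  have := h.map_mul_le (div_nonneg hx ha.le) ((div_le_one ha).2 (h.le_a hx h1)) ha.le
  rw [div_mul_cancel₀ _ ha.ne', h.phi_a, mul_one, le_div_iff₀ ha] at this
  linarith

lemma exists_preimage (h : IsProfile φ D k s m a) {y : ℝ} (hy : 0 < y) (hy1 : y ≤ 1) :
    ∃ x ∈ Ioi (0 : ℝ), φ x = y := by
  have := intermediate_value_Icc h.a_pos.le (h.continuousOn_Ici.mono Icc_subset_Ici_self)
  rw [h.map_zero, h.phi_a] at this
  obtain ⟨x, hx, rfl⟩ := this ⟨hy.le, hy1⟩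
  refine ⟨x, mem_Ioi.2 (lt_of_le_of_ne hx.1 ?_), rfl⟩
  rintro rfl
  exact hy.ne' h.map_zero

lemma phiInv_pos (h : IsProfile φ D k s m a) {y : ℝ} (hy : 0 < y) (hy1 : y ≤ 1) :
    0 < phiInv φ y :=
  Function.invFunOn_mem (h.exists_preimage hy hy1)

lemma map_phiInv (h : IsProfile φ D k s m a) {y : ℝ} (hy : 0 < y) (hy1 : y ≤ 1) :
    φ (phiInv φ y) = y :=
  Function.invFunOn_eq (h.exists_preimage hy hy1)

lemma phiInv_mono (h : IsProfile φ D k s m a) {x y : ℝ} (hx : 0 < x) (hxy : x ≤ y) (hy : y ≤ 1) :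
    phiInv φ x ≤ phiInv φ y := by
  have hx1 := hxy.trans hy
  have hy0 := hx.trans_le hxy
  rw [← h.strictMonoOn_Ici.le_iff_le (h.phiInv_pos hx hx1).le (h.phiInv_pos hy0 hy).le,
    h.map_phiInv hx hx1, h.map_phiInv hy0 hy]
  exact hxy

/-- The inverse of a convex function vanishing at `0` grows at most linearly under dilation. -/
lemma phiInv_le_mul (h : IsProfile φ D k s m a) {x y c : ℝ} (hx : 0 < x) (hx1 : x ≤ 1)
    (hy : 0 < y) (hy1 : y ≤ 1) (hc : 1 ≤ c) (hyx : y ≤ c * x) :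
    phiInv φ y ≤ c * phiInv φ x := by
  have hc0 : 0 < c := by linarith
  have hpy := h.phiInv_pos hy hy1
  have hpx := h.phiInv_pos hx hx1
  have := h.map_mul_le (inv_nonneg.2 hc0.le) (inv_le_one_of_one_le₀ hc) hpy.le
  rw [h.map_phiInv hy hy1] at this
  have h2 : φ (c⁻¹ * phiInv φ y) ≤ φ (phiInv φ x) := by
    rw [h.map_phiInv hx hx1]
    refine this.trans ?_
    rwa [inv_mul_le_iff₀ hc0]
  rw [h.strictMonoOn_Ici.le_iff_le (mem_Ici.2 (by positivity)) hpx.le,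
    inv_mul_le_iff₀ hc0] at h2
  exact h2

end IsProfile

/-! ### Derivatives of discs, and approximation by convex functions. -/

/-- A holomorphic function on the unit disc which vanishes at the centre and has values in the
half plane `Re ≤ M` has derivative at most `2 M` at the centre. -/
lemma norm_deriv_le_two_mul_of_re_le {f : ℂ → ℂ} {M : ℝ} (hM : 0 < M)
    (hf : DifferentiableOn ℂ f (Metric.ball 0 1)) (hre : ∀ z ∈ Metric.ball (0 : ℂ) 1, (f z).re ≤ M)
    (h0 : f 0 = 0) : ‖deriv f 0‖ ≤ 2 * M := by
  have hball : Metric.ball (0 : ℂ) 1 ∈ 𝓝 0 := Metric.ball_mem_nhds _ one_pos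
  have hd := ((hf.differentiableAt hball).hasDerivAt.tendsto_slope_zero).norm
  have hlim : Tendsto (fun t : ℂ => 2 * M / (1 - ‖t‖)) (𝓝[≠] 0) (𝓝 (2 * M)) := by
    have : ContinuousAt (fun t : ℂ => 2 * M / (1 - ‖t‖)) 0 := by
      refine ContinuousAt.div ?_ ?_ ?_
      · fun_prop
      · fun_prop
      · simp
    have h2 := this.tendsto
    simp only [norm_zero, sub_zero, div_one] at h2
    exact h2.mono_left nhdsWithin_le_nhds
  refine le_of_tendsto_of_tendsto hd hlim ?_
  filter_upwards [self_mem_nhdsWithin, mem_nhdsWithin_of_mem_nhds hball] with t ht htb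
  have htn : 0 < ‖t‖ := norm_pos_iff.2 ht
  -- This bounds `‖f t‖` by `2M‖t‖ / (1 - ‖t‖)`; divide by `‖t‖` and let `t → 0`.
  have := Complex.borelCaratheodory_zero hM hf hre one_pos htb h0
  rw [zero_add, h0, sub_zero, norm_smul, norm_inv, inv_mul_le_iff₀ htn]
  refine this.trans_eq (by ring)

/-- A convex function on `ℂⁿ` is continuous and plurisubharmonic. -/
lemma ConvexOn.isContPSHOn_univ {m : ℕ} {u : CSpace m → ℝ} (hu : ConvexOn ℝ univ u) :
    IsContPSHOn u univ := by
  have hc : ContinuousOn u univ := hu.continuousOn isOpen_univ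
  refine ⟨isOpen_univ, hc, fun z v _ => ?_⟩
  have hc' : Continuous u := continuousOn_univ.1 hc
  -- Rotation by `π` preserves the average, so midpoint convexity at `z ± lam • v` suffices.
  have hneg : Real.circleAverage (fun lam : ℂ => u (z + lam • v)) 0 1
      = Real.circleAverage (fun lam : ℂ => u (z + (-lam) • v)) 0 1 := by
    rw [Real.circleAverage_eq_integral_add Real.pi, Real.circleAverage_def]
    simp [circleMap, add_mul, Complex.exp_add]
  have hi : CircleIntegrable (fun lam : ℂ => u (z + lam • v)) 0 1 :=
    Continuous.continuousOn (by fun_prop) |>.circleIntegrable'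
  have hi' : CircleIntegrable (fun lam : ℂ => u (z + (-lam) • v)) 0 1 :=
    Continuous.continuousOn (by fun_prop) |>.circleIntegrable'
  have hsum := Real.circleAverage_fun_add hi hi'
  rw [← hneg] at hsum
  have hmono : Real.circleAverage (fun _ : ℂ => 2 * u z) 0 1 ≤
      Real.circleAverage (fun lam : ℂ => u (z + lam • v) + u (z + (-lam) • v)) 0 1 := by
    refine Real.circleAverage_mono (circleIntegrable_const _ _ _) (hi.add hi') fun lam _ => ?_
    have := hu.2 (mem_univ (z + lam • v)) (mem_univ (z + (-lam) • v))
      (by norm_num : (0 : ℝ) ≤ 1 / 2) (by norm_num : (0 : ℝ) ≤ 1 / 2) (by norm_num)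
    have e : (1 / 2 : ℝ) • (z + lam • v) + (1 / 2 : ℝ) • (z + (-lam) • v) = z := by
      rw [← smul_add, neg_smul, add_add_add_comm, add_neg_cancel, add_zero, ← two_smul ℝ z,
        smul_smul]
      norm_num
    rw [e] at this
    simp only [smul_eq_mul] at this
    linarith
  rw [Real.circleAverage_const] at hmono
  linarith

/-- If there are functions `w`, arbitrarily small on the compact set `K`, with `w - ‖·‖²` convex,
then every continuous function on `K` is a uniform limit of convex functions: sup-convolutions
approximate it and are convex up to a multiple of `‖·‖²`. -/
lemma exists_convexOn_approx {m : ℕ} {K : Set (CSpace m)} (hK : IsCompact K) (hne : K.Nonempty)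
    (hw : ∀ ε : ℝ, 0 < ε → ∃ w : CSpace m → ℝ, ConvexOn ℝ univ (fun z => w z - ‖z‖ ^ 2) ∧
      ∀ z ∈ K, |w z| ≤ ε)
    {g : CSpace m → ℝ} (hg : ContinuousOn g K) {ε : ℝ} (hε : 0 < ε) :
    ∃ u : CSpace m → ℝ, ConvexOn ℝ univ u ∧ ∀ z ∈ K, |u z - g z| ≤ ε := by
  obtain ⟨δ, hδ, hgδ⟩ := Metric.uniformContinuousOn_iff.1
    (hK.uniformContinuousOn_of_continuous hg) (ε / 2) (half_pos hε)
  obtain ⟨B, hB⟩ := hK.exists_bound_of_continuousOn hg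
  have hB0 : 0 ≤ B := (norm_nonneg _).trans (hB _ hne.some_mem)
  -- With this `N` the penalty at distance at least `δ` exceeds the oscillation `2B` of `g`.
  set N : ℝ := 2 * B / δ ^ 2 + 1 with hN
  have hN0 : 0 < N := by positivity
  have hNδ : 2 * B ≤ N * δ ^ 2 := by
    rw [hN, add_mul, div_mul_cancel₀ _ (by positivity)]
    nlinarith [sq_nonneg δ]
  obtain ⟨w, hwc, hwK⟩ := hw (ε / (2 * N)) (by positivity)
  -- The sup-convolution kernel plus `N‖x‖²`: real-affine in `x`, so its supremum over `y` is
  -- convex.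
  let T : CSpace m → CSpace m → ℝ := fun x y =>
    g y - N * ‖y‖ ^ 2 + 2 * N * RCLike.re (inner ℂ x y)
  have hT : ∀ x y, T x y = g y - N * ‖x - y‖ ^ 2 + N * ‖x‖ ^ 2 := by
    intro x y
    simp only [T]
    rw [norm_sub_sq (𝕜 := ℂ) x y]
    ring
  have hbdd : ∀ x, BddAbove (T x '' K) := by
    intro x
    refine hK.bddAbove_image ?_
    have h1 : Continuous fun y : CSpace m => (N * ‖y‖ ^ 2 : ℝ) := by fun_prop
    have h2 : Continuous fun y : CSpace m => (2 * N * RCLike.re (inner ℂ x y) : ℝ) := by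
      fun_prop
    exact (hg.sub h1.continuousOn).add h2.continuousOn
  let S : CSpace m → ℝ := fun x => sSup (T x '' K)
  have hle : ∀ x, ∀ y ∈ K, T x y ≤ S x := fun x y hy => le_csSup (hbdd x) (mem_image_of_mem _ hy)
  have hS : ConvexOn ℝ univ S := by
    refine ⟨convex_univ, fun x _ y _ b c hb hc hbc => ?_⟩
    refine csSup_le (hne.image _) ?_
    rintro _ ⟨p, hp, rfl⟩
    have e : T (b • x + c • y) p = b * T x p + c * T y p := by
      have hb' : b • x = (b : ℂ) • x := (Complex.coe_smul b x).symm
      have hc' : c • y = (c : ℂ) • y := (Complex.coe_smul c y).symm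
      simp only [T, hb', hc', inner_add_left, inner_smul_left]
      simp
      linear_combination (-(g p - N * ‖p‖ ^ 2)) * hbc
    rw [e]
    exact add_le_add (mul_le_mul_of_nonneg_left (hle x p hp) hb)
      (mul_le_mul_of_nonneg_left (hle y p hp) hc)
  refine ⟨fun z => S z + N * (w z - ‖z‖ ^ 2), hS.add (hwc.smul hN0.le), fun z hz => ?_⟩
  have h1 : g z + N * ‖z‖ ^ 2 ≤ S z := by
    have := hle z z hz
    rw [hT] at this
    simpa using this
  have h2 : S z ≤ g z + ε / 2 + N * ‖z‖ ^ 2 := by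
    refine csSup_le (hne.image _) ?_
    rintro _ ⟨p, hp, rfl⟩
    rw [hT]
    gcongr
    rcases lt_or_ge (dist p z) δ with hd | hd
    · have := hgδ p hp z hz hd
      rw [Real.dist_eq] at this
      have h3 := (abs_lt.1 this).2
      nlinarith [mul_nonneg hN0.le (sq_nonneg ‖z - p‖)]
    · rw [dist_comm, dist_eq_norm] at hd
      have h3 : N * δ ^ 2 ≤ N * ‖z - p‖ ^ 2 := by gcongr
      have h4 := (abs_le.1 (hB p hp)).2
      have h5 := (abs_le.1 (hB z hz)).1
      linarith
  have h3 : |N * w z| ≤ ε / 2 := by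
    rw [abs_mul, abs_of_pos hN0]
    calc N * |w z| ≤ N * (ε / (2 * N)) := by gcongr; exact hwK z hz
      _ = ε / 2 := by field_simp
  rw [abs_le] at h3 ⊢
  constructor <;> nlinarith [h3.1, h3.2]

/-- A bounded domain on whose boundary all continuous functions are uniform limits of convex
functions is `B`-regular. -/
lemma IsBRegularDomain.of_convexOn_approx {m : ℕ} {Ω : Set (CSpace m)} (ho : IsOpen Ω)
    (hc : IsConnected Ω) (hb : Bornology.IsBounded Ω)
    (happ : ∀ g : CSpace m → ℝ, ContinuousOn g (frontier Ω) → ∀ ε : ℝ, 0 < ε →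
      ∃ u : CSpace m → ℝ, ConvexOn ℝ univ u ∧ ∀ z ∈ frontier Ω, |u z - g z| ≤ ε) :
    IsBRegularDomain Ω := by
  refine ⟨ho, hc, hb, fun g hg => ?_⟩
  choose u hu hug using fun ν : ℕ => happ g hg (1 / ((ν : ℝ) + 1)) (by positivity)
  refine ⟨fun _ => univ, u, fun ν => ⟨subset_univ _, (hu ν).isContPSHOn_univ⟩, ?_⟩
  rw [Metric.tendstoUniformlyOn_iff]
  intro ε hε
  filter_upwards [tendsto_one_div_add_atTop_nhds_zero_nat.eventually_lt_const hε] with ν hν z hz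
  rw [dist_comm, Real.dist_eq]
  exact (hug ν z hz).trans_lt hν

/-! ### Weights on the boundary and B-regularity. -/

lemma CSpace.norm_sq_eq {m : ℕ} (z : CSpace m) :
    ‖z‖ ^ 2 = ‖z 0‖ ^ 2 + ∑ j : Fin m, ‖z j.succ‖ ^ 2 := by
  rw [EuclideanSpace.norm_sq_eq, Fin.sum_univ_succ]

lemma CSpace.convexOn_norm_sq_apply {m : ℕ} (i : Fin (m + 1)) :
    ConvexOn ℝ univ (fun z : CSpace m => ‖z i‖ ^ 2) := by
  refine ConvexOn.pow (f := fun z : CSpace m => ‖z i‖) ⟨convex_univ, fun x _ y _ b c hb hc _ => ?_⟩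
    (fun _ _ => norm_nonneg _) 2
  calc ‖(b • x + c • y) i‖ = ‖b • x i + c • y i‖ := rfl
    _ ≤ ‖b • x i‖ + ‖c • y i‖ := norm_add_le _ _
    _ = b • ‖x i‖ + c • ‖y i‖ := by
      rw [norm_smul, norm_smul, Real.norm_of_nonneg hb, Real.norm_of_nonneg hc, smul_eq_mul,
        smul_eq_mul]

lemma CSpace.convexOn_comp_norm_sq_apply {m : ℕ} (i : Fin (m + 1)) {E : ℝ → ℝ}
    (hE : ConvexOn ℝ (Ici 0) E) (hmono : MonotoneOn E (Ici 0)) :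
    ConvexOn ℝ univ (fun z : CSpace m => E (‖z i‖ ^ 2)) := by
  refine ⟨convex_univ, fun x _ y _ b c hb hc hbc => ?_⟩
  have h1 := (CSpace.convexOn_norm_sq_apply i).2 (mem_univ x) (mem_univ y) hb hc hbc
  have hx : (0 : ℝ) ≤ ‖x i‖ ^ 2 := by positivity
  have hy : (0 : ℝ) ≤ ‖y i‖ ^ 2 := by positivity
  exact (hmono (mem_Ici.2 (by positivity)) (hE.1 hx hy hb hc hbc) h1).trans
    (hE.2 hx hy hb hc hbc)

namespace IsProfile

variable {φ : ℝ → ℝ} {D : ℕ → ℝ} {k s m : ℕ} {a : ℝ}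

lemma continuous_defining (h : IsProfile φ D k s m a) :
    Continuous fun z : CSpace m => φ (‖z 0‖ ^ 2) + ∑ j : Fin m, ‖z j.succ‖ ^ 2 := by
  refine Continuous.add ?_ (by fun_prop)
  exact h.continuousOn_Ici.comp_continuous (f := fun z : CSpace m => ‖z 0‖ ^ 2) (by fun_prop)
    fun z => mem_Ici.2 (by positivity)

lemma eq_one_of_mem_frontier (h : IsProfile φ D k s m a) {z : CSpace m}
    (hz : z ∈ frontier (OmegaPhi φ m)) : φ (‖z 0‖ ^ 2) + ∑ j : Fin m, ‖z j.succ‖ ^ 2 = 1 :=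
  frontier_lt_subset_eq h.continuous_defining continuous_const hz

lemma isBounded (h : IsProfile φ D k s m a) : Bornology.IsBounded (OmegaPhi φ m) := by
  refine (Metric.isBounded_closedBall (x := (0 : CSpace m)) (r := a + 1)).subset fun z hz => ?_
  have hz : φ (‖z 0‖ ^ 2) + ∑ j : Fin m, ‖z j.succ‖ ^ 2 < 1 := hz
  have h0 : 0 ≤ ∑ j : Fin m, ‖z j.succ‖ ^ 2 := Finset.sum_nonneg fun _ _ => by positivity
  have h1 := h.map_nonneg (sq_nonneg ‖z 0‖)
  have h2 := h.le_a (sq_nonneg ‖z 0‖) (by linarith)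
  rw [mem_closedBall_zero_iff]
  have := CSpace.norm_sq_eq z
  nlinarith [h.a_pos, norm_nonneg z]

lemma frontier_nonempty (h : IsProfile φ D k s m a) : (frontier (OmegaPhi φ m)).Nonempty := by
  rw [nonempty_frontier_iff]
  refine ⟨h.isConnected.nonempty, fun hu => ?_⟩
  have := h.isBounded
  rw [hu] at this
  exact NormedSpace.unbounded_univ ℝ (CSpace m) this

/-- Flatness gives `φ(x) / x → 0`; this makes the multiplier `δ / φ δ` at least `1`. -/
lemma exists_small (h : IsProfile φ D k s m a) {ε : ℝ} (hε : 0 < ε) :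
    ∃ δ, 0 < δ ∧ δ ≤ ε ∧ φ δ ≤ δ := by
  have h1 := h.diffQuot 1 le_rfl (one_le_two.trans h.two_le)
  rw [h.flat 1 h.one_le_s] at h1
  obtain ⟨δ, hδ1, hδ2, hδ3⟩ := ((h1.eventually_lt_const one_pos).and
    (Ioo_mem_nhdsGT hε)).exists
  rw [h.flat 0 (Nat.zero_le _), Nat.sub_self, iteratedDeriv_zero, sub_zero, div_lt_one hδ2] at hδ1
  exact ⟨δ, hδ2, hδ3.le, hδ1.le⟩

/-- The function `t ↦ (δ / φ(δ)) φ(t) - t`, made constant on `[0, δ]`, is nondecreasing. -/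
lemma monotone_flattened (h : IsProfile φ D k s m a) {δ : ℝ} (hδ : 0 < δ) :
    MonotoneOn (fun t => δ / φ δ * φ t - t) (Ici δ) := by
  intro x hx y hy hxy
  rw [mem_Ici] at hx hy
  have hy0 : 0 < y := hδ.trans_le hy
  have hφ := h.pos δ hδ
  have h1 := h.map_mul_le (div_nonneg (hδ.le.trans hx) hy0.le) ((div_le_one hy0).2 hxy) hy0.le
  have h2 := h.map_mul_le (div_nonneg hδ.le hy0.le) ((div_le_one hy0).2 hy) hy0.le
  rw [div_mul_cancel₀ _ hy0.ne'] at h1 h2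
  have h3 : y ≤ δ / φ δ * φ y := by
    rw [div_mul_eq_mul_div, le_div_iff₀ hφ]
    rw [div_mul_eq_mul_div, le_div_iff₀ hy0] at h2
    linarith
  -- With `F t = (δ / φ δ) φ t - t`, this gives `F x ≤ (x / y) F y`, while `h3` says `F y ≥ 0`.
  have h4 : δ / φ δ * φ x ≤ x / y * (δ / φ δ * φ y) := by
    calc δ / φ δ * φ x ≤ δ / φ δ * (x / y * φ y) := by gcongr
      _ = _ := by ring
  have h5 : 0 ≤ (1 - x / y) * (δ / φ δ * φ y - y) :=
    mul_nonneg (sub_nonneg.2 ((div_le_one hy0).2 hxy)) (sub_nonneg.2 h3)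
  have h6 : x / y * y = x := div_mul_cancel₀ _ hy0.ne'
  show δ / φ δ * φ x - x ≤ δ / φ δ * φ y - y
  nlinarith

lemma exists_weight (h : IsProfile φ D k s m a) {ε : ℝ} (hε : 0 < ε) :
    ∃ w : CSpace m → ℝ, ConvexOn ℝ univ (fun z => w z - ‖z‖ ^ 2) ∧
      ∀ z ∈ frontier (OmegaPhi φ m), |w z| ≤ ε := by
  obtain ⟨δ, hδ, hδε, hφδ⟩ := h.exists_small hε
  have hφ := h.pos δ hδ
  set M : ℝ := δ / φ δ with hM
  have hM1 : 1 ≤ M := (one_le_div hφ).2 hφδ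
  let F : ℝ → ℝ := fun t => M * φ t - t
  have hFmono : MonotoneOn F (Ici δ) := h.monotone_flattened hδ
  have hFδ : F δ = 0 := by simp only [F, hM]; rw [div_mul_cancel₀ _ hφ.ne', sub_self]
  have hFconv : ConvexOn ℝ (Ici 0) F :=
    (h.convexOn_Ici.smul (by linarith : (0 : ℝ) ≤ M)).sub (concaveOn_id (convex_Ici 0))
  let E : ℝ → ℝ := fun t => F (max t δ)
  have hmem : ∀ x, max x δ ∈ Ici δ := fun x => mem_Ici.2 (le_max_right _ _)
  have hEmono : MonotoneOn E (Ici 0) := fun x _ y _ hxy =>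
    hFmono (hmem x) (hmem y) (max_le_max_right _ hxy)
  have hEconv : ConvexOn ℝ (Ici 0) E := by
    refine ⟨convex_Ici 0, fun x hx y hy b c hb hc hbc => ?_⟩
    have hx' : max x δ ∈ Ici (0 : ℝ) := mem_Ici.2 (hδ.le.trans (le_max_right _ _))
    have hy' : max y δ ∈ Ici (0 : ℝ) := mem_Ici.2 (hδ.le.trans (le_max_right _ _))
    have hδ' : δ ≤ b • max x δ + c • max y δ :=
      convex_Ici δ (hmem x) (hmem y) hb hc hbc
    refine le_trans (hFmono (hmem _) hδ' (max_le ?_ hδ')) (hFconv.2 hx' hy' hb hc hbc)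
    simp only [smul_eq_mul]
    gcongr <;> exact le_max_left _ _
  -- Here `w - ‖z‖² = E(|z₁|²) + (M - 1) ∑ |z_j|² - M`, which is convex. On the boundary only `E -
  -- F` survives: it vanishes for `|z₁|² ≥ δ` and lies in `[0, δ]` otherwise.
  refine ⟨fun z => M * (φ (‖z 0‖ ^ 2) + ∑ j : Fin m, ‖z j.succ‖ ^ 2 - 1) +
    (E (‖z 0‖ ^ 2) - F (‖z 0‖ ^ 2)), ?_, fun z hz => ?_⟩
  · have hsum : ConvexOn ℝ univ fun z : CSpace m => ∑ j : Fin m, ‖z j.succ‖ ^ 2 := by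
      refine ⟨convex_univ, fun x _ y _ b c hb hc hbc => ?_⟩
      simp only [smul_eq_mul, Finset.mul_sum, ← Finset.sum_add_distrib]
      exact Finset.sum_le_sum fun j _ =>
        (CSpace.convexOn_norm_sq_apply j.succ).2 (mem_univ x) (mem_univ y) hb hc hbc
    have := ((CSpace.convexOn_comp_norm_sq_apply (m := m) 0 hEconv hEmono).add
      (hsum.smul (sub_nonneg.2 hM1))).add (convexOn_const (-M) convex_univ)
    refine this.congr fun z _ => ?_
    simp only [CSpace.norm_sq_eq z, F, Pi.add_apply, smul_eq_mul]
    ring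
  · have ht : (0 : ℝ) ≤ ‖z 0‖ ^ 2 := by positivity
    simp only
    rw [h.eq_one_of_mem_frontier hz, sub_self, mul_zero, zero_add]
    refine le_trans ?_ hδε
    rcases le_total δ (‖z 0‖ ^ 2) with hle | hle
    · simp only [E, max_eq_left hle, sub_self, abs_zero]
      exact hδ.le
    · simp only [E, max_eq_right hle, hFδ]
      have h1 := h.map_nonneg ht
      have h2 := h.map_mul_le (div_nonneg ht hδ.le) ((div_le_one hδ).2 hle) hδ.le
      rw [div_mul_cancel₀ _ hδ.ne'] at h2
      have h3 : M * φ (‖z 0‖ ^ 2) ≤ ‖z 0‖ ^ 2 := by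
        rw [hM, div_mul_eq_mul_div, div_le_iff₀ hφ]
        rw [div_mul_eq_mul_div, le_div_iff₀ hδ] at h2
        linarith
      have h4 : 0 ≤ M * φ (‖z 0‖ ^ 2) := by positivity
      simp only [F]
      rw [abs_le]
      constructor <;> linarith

lemma isBRegularDomain (h : IsProfile φ D k s m a) : IsBRegularDomain (OmegaPhi φ m) :=
  .of_convexOn_approx h.isOpen h.isConnected h.isBounded fun _ hg _ hε =>
    exists_convexOn_approx (Metric.isCompact_of_isClosed_isBounded isClosed_frontier
      (h.isBounded.closure.subset frontier_subset_closure))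
      h.frontier_nonempty (fun _ => h.exists_weight) hg hε

end IsProfile

/-! ### The slice through `z_ε` and the distance to the boundary. -/

lemma zPoint_zero {m : ℕ} (l : Fin m) (ε : ℝ) : zPoint l ε 0 = 0 := by
  simp [zPoint]

lemma sum_zPoint {m : ℕ} (l : Fin m) (ε : ℝ) :
    ∑ j : Fin m, ‖zPoint l ε j.succ‖ ^ 2 = ε ^ 2 := by
  rw [Finset.sum_eq_single l]
  · simp [zPoint]
  · intro j _ hj
    simp [zPoint, hj]
  · simp

lemma mem_OmegaPhi_zPoint_add {φ : ℝ → ℝ} {m : ℕ} (l : Fin m) (ε : ℝ) (c : ℂ) :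
    zPoint l ε + c • eOne m ∈ OmegaPhi φ m ↔ φ (‖c‖ ^ 2) < 1 - ε ^ 2 := by
  have h0 : (zPoint l ε + c • eOne m) 0 = c := by simp [zPoint_zero, eOne]
  have hs : ∀ j : Fin m, (zPoint l ε + c • eOne m) j.succ = zPoint l ε j.succ := by
    intro j; simp [eOne]
  simp only [OmegaPhi, mem_ofPred_eq, h0, hs, sum_zPoint]
  exact lt_sub_iff_add_lt.symm

lemma mem_OmegaPhi_zPoint {φ : ℝ → ℝ} {m : ℕ} (l : Fin m) (ε : ℝ) :
    zPoint l ε ∈ OmegaPhi φ m ↔ φ 0 < 1 - ε ^ 2 := by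
  simpa using mem_OmegaPhi_zPoint_add (φ := φ) l ε 0

namespace IsProfile

variable {φ : ℝ → ℝ} {D : ℕ → ℝ} {k s m : ℕ} {a : ℝ}

lemma zPoint_neg_one_mem_frontier (h : IsProfile φ D k s m a) (l : Fin m) :
    zPoint l (-1) ∈ frontier (OmegaPhi φ m) := by
  rw [h.isOpen.frontier_eq]
  refine ⟨?_, by rw [mem_OmegaPhi_zPoint, h.map_zero]; norm_num⟩
  have hcont : Continuous fun t : ℝ => zPoint l t := by
    have : (fun t : ℝ => zPoint l t) = fun t : ℝ => (t : ℂ) • EuclideanSpace.single l.succ 1 := by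
      funext t
      ext i
      simp [zPoint]
    rw [this]
    fun_prop
  refine mem_closure_of_tendsto (b := 𝓝[>] (-1 : ℝ))
    ((hcont.tendsto (-1)).mono_left nhdsWithin_le_nhds) ?_
  filter_upwards [Ioo_mem_nhdsGT (by norm_num : (-1 : ℝ) < 0)] with t ht
  rw [mem_OmegaPhi_zPoint, h.map_zero]
  nlinarith [ht.1, ht.2]

lemma bdryDist_le (h : IsProfile φ D k s m a) (l : Fin m) {ε : ℝ} (hε : -1 < ε) :
    bdryDist (OmegaPhi φ m) (zPoint l ε) ≤ 1 + ε := by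
  refine (Metric.infDist_le_dist_of_mem (h.zPoint_neg_one_mem_frontier l)).trans_eq ?_
  rw [zPoint, zPoint, PiLp.dist_single_same, dist_eq_norm, ← Complex.ofReal_sub,
    Complex.norm_real, Real.norm_of_nonneg (by linarith)]
  ring

/-- Take `y` to be the norm of the last `m` coordinates of `w`. The chord bound gives `|w₁|² ≥ a(1 -
y²)`, and the reverse triangle inequality handles the rest, reducing the distance to a quadratic in
`y`. -/
lemma exists_le_dist_sq (h : IsProfile φ D k s m a) (l : Fin m) {ε : ℝ} (hε : ε ≤ 0)
    {w : CSpace m} (hw : w ∈ frontier (OmegaPhi φ m)) :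
    ∃ y : ℝ, 0 ≤ y ∧ y ≤ 1 ∧ a * (1 - y ^ 2) + (y + ε) ^ 2 ≤ dist (zPoint l ε) w ^ 2 := by
  have h1 := h.eq_one_of_mem_frontier hw
  have ht : (0 : ℝ) ≤ ‖w 0‖ ^ 2 := by positivity
  let v : EuclideanSpace ℂ (Fin m) := WithLp.toLp 2 fun j => w j.succ
  let p : EuclideanSpace ℂ (Fin m) := WithLp.toLp 2 fun j => zPoint l ε j.succ
  have hv : ‖v‖ ^ 2 = ∑ j : Fin m, ‖w j.succ‖ ^ 2 := EuclideanSpace.norm_sq_eq v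
  have hp : ‖p‖ = -ε := by
    have : ‖p‖ ^ 2 = ε ^ 2 := (EuclideanSpace.norm_sq_eq p).trans (sum_zPoint l ε)
    rw [← neg_sq ε] at this
    exact (sq_eq_sq₀ (norm_nonneg _) (by linarith)).1 this
  have hd : dist (zPoint l ε) w ^ 2 = ‖w 0‖ ^ 2 + ‖v - p‖ ^ 2 := by
    rw [dist_comm, dist_eq_norm, CSpace.norm_sq_eq, EuclideanSpace.norm_sq_eq (v - p)]
    simp [v, p, zPoint_zero]
  have hφ0 := h.map_nonneg ht
  have hφ1 : φ (‖w 0‖ ^ 2) = 1 - ‖v‖ ^ 2 := by rw [hv]; linarith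
  have h2 := h.mul_map_le ht (by rw [hφ1]; nlinarith [sq_nonneg ‖v‖])
  have h3 : (‖v‖ - ‖p‖) ^ 2 ≤ ‖v - p‖ ^ 2 := by
    rw [← sq_abs (‖v‖ - ‖p‖)]
    gcongr
    exact abs_norm_sub_norm_le v p
  refine ⟨‖v‖, norm_nonneg _, ?_, ?_⟩
  · nlinarith [norm_nonneg v]
  · rw [hd, ← hφ1]
    rw [hp] at h3
    nlinarith

lemma le_bdryDist (h : IsProfile φ D k s m a) (l : Fin m) {ε c : ℝ} (hε : ε ≤ 0) (hc : 0 ≤ c)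
    (hle : ∀ y : ℝ, 0 ≤ y → y ≤ 1 → c ^ 2 ≤ a * (1 - y ^ 2) + (y + ε) ^ 2) :
    c ≤ bdryDist (OmegaPhi φ m) (zPoint l ε) := by
  refine (Metric.le_infDist h.frontier_nonempty).2 fun {w} hw => ?_
  obtain ⟨y, hy0, hy1, hy⟩ := h.exists_le_dist_sq l hε hw
  exact (sq_le_sq₀ hc dist_nonneg).1 ((hle y hy0 hy1).trans hy)

lemma one_add_le_bdryDist (h : IsProfile φ D k s m a) (l : Fin m) {ε : ℝ} (h1 : -1 < ε)
    (h2 : ε ≤ 0) (ha : 1 + ε ≤ a) : 1 + ε ≤ bdryDist (OmegaPhi φ m) (zPoint l ε) := by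
  refine h.le_bdryDist l h2 (by linarith) fun y hy0 hy1 => ?_
  -- The quadratic minus `(1 + ε)²` is exactly the sum of these two terms.
  have e1 : 0 ≤ (a - (1 + ε)) * (1 - y ^ 2) := mul_nonneg (by linarith) (by nlinarith)
  have e2 : 0 ≤ -ε * (1 - y) ^ 2 := mul_nonneg (by linarith) (sq_nonneg _)
  nlinarith

lemma quarter_le_bdryDist (h : IsProfile φ D k s m a) (l : Fin m) {ε : ℝ}
    (h1 : -3 / 4 ≤ ε) (h2 : ε ≤ -1 / 2) (ha : 1 / 4 ≤ a) :
    (1 - ε ^ 2) / 4 ≤ bdryDist (OmegaPhi φ m) (zPoint l ε) := by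
  refine h.le_bdryDist l (by linarith) (by nlinarith) fun y hy0 hy1 => ?_
  have e1 : 0 ≤ (a - 1 / 4) * (1 - y ^ 2) := mul_nonneg (by linarith) (by nlinarith)
  -- For `a = 1/4` the quadratic is `1/4 - ε²/3 + (3y + 4ε)²/12`.
  have e2 : 0 ≤ (3 * y + 4 * ε) ^ 2 := sq_nonneg _
  have e3 : ε ^ 2 ≤ 9 / 16 := by nlinarith
  have e4 : 1 / 4 ≤ ε ^ 2 := by nlinarith
  nlinarith

lemma a_le_bdryDist (h : IsProfile φ D k s m a) (l : Fin m) {ε : ℝ} (h2 : ε ≤ 0)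
    (ha : a ≤ 1 + ε) : a ≤ bdryDist (OmegaPhi φ m) (zPoint l ε) := by
  have ha0 := h.a_pos
  refine h.le_bdryDist l h2 ha0.le fun y hy0 hy1 => ?_
  rcases eq_or_lt_of_le h2 with rfl | h2
  · nlinarith [sq_nonneg y, mul_nonneg ha0.le (sub_nonneg.2 ha)]
  have e1 : (0 : ℝ) < 1 - a := by linarith
  have e2 : 0 ≤ ((1 - a) * y + ε) ^ 2 := sq_nonneg _
  have e3 : ε ^ 2 ≤ (1 - a) ^ 2 := by nlinarith
  have e4 : 0 ≤ a * ((1 - a) ^ 2 - ε ^ 2) := mul_nonneg ha0.le (by linarith)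
  -- Completing the square: this product is the sum of the terms in `e2` and `e4`.
  have e5 : 0 ≤ (1 - a) * (a * (1 - y ^ 2) + (y + ε) ^ 2 - a ^ 2) := by nlinarith
  have := nonneg_of_mul_nonneg_right e5 e1
  linarith

/-! ### Disc radius and Kobayashi metric. -/

/-- A holomorphic disc in `Ω_φ` centred at `z_ε` and tangent to the first axis has derivative at
most `2 R`, where `R` is the radius of the affine disc in that direction. -/
lemma norm_deriv_apply_zero_le (h : IsProfile φ D k s m a) (l : Fin m) {ε R : ℝ} (hR : 0 < R)
    (hφR : φ (R ^ 2) = 1 - ε ^ 2) {f : ℂ → CSpace m}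
    (hf : DifferentiableOn ℂ f (Metric.ball 0 1))
    (hmaps : MapsTo f (Metric.ball 0 1) (OmegaPhi φ m)) (h0 : f 0 = zPoint l ε) {c : ℂ}
    (hc : deriv f 0 = c • eOne m) : ‖c‖ ≤ 2 * R := by
  have hp : zPoint l ε + (R : ℂ) • eOne m ∉ OmegaPhi φ m := by
    rw [mem_OmegaPhi_zPoint_add, Complex.norm_real, Real.norm_of_nonneg hR.le, hφR]
    exact lt_irrefl _
  -- The hyperplane separates `Ω_φ` from the rim point, so `Re (L ∘ f - L z_ε) ≤ R Re L(e₁) ≤ R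
  -- ‖L(e₁)‖`, and the half-plane estimate applies.
  obtain ⟨L, hL⟩ := RCLike.geometric_hahn_banach_open_point (𝕜 := ℂ) h.convex h.isOpen hp
  have hball : Metric.ball (0 : ℂ) 1 ∈ 𝓝 0 := Metric.ball_mem_nhds _ one_pos
  have hz := hL _ (h0 ▸ hmaps (Metric.mem_ball_self one_pos))
  simp only [map_add, map_smul, smul_eq_mul, RCLike.re_to_complex,
    Complex.re_ofReal_mul] at hL hz
  have hLe : 0 < R * (L (eOne m)).re := by linarith
  have hd : HasDerivAt (fun t => L (f t) - L (zPoint l ε)) (L (deriv f 0)) 0 :=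
    (L.hasFDerivAt.comp_hasDerivAt _ (hf.differentiableAt hball).hasDerivAt).sub_const _
  have hb := norm_deriv_le_two_mul_of_re_le (f := fun t => L (f t) - L (zPoint l ε)) hLe
    ((L.differentiable.comp_differentiableOn hf).sub_const _)
    (fun t ht => by
      have := hL _ (hmaps ht)
      simp only [Complex.sub_re]
      linarith) (by simp [h0])
  rw [hd.deriv, hc, map_smul, norm_smul] at hb
  have hpos : 0 < (L (eOne m)).re := (mul_pos_iff_of_pos_left hR).1 hLe
  have hle : (L (eOne m)).re ≤ ‖L (eOne m)‖ := Complex.re_le_norm _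
  have hn := hpos.trans_le hle
  refine le_of_mul_le_mul_right (hb.trans ?_) hn
  rw [← mul_assoc]
  gcongr

lemma axisEstimates_of_phiInv_le (h : IsProfile φ D k s m a) (l : Fin m) {ε C : ℝ}
    (h1 : -1 < ε) (h2 : ε < -1 / 2) (hC : 0 < C)
    (hpos : 0 < bdryDist (OmegaPhi φ m) (zPoint l ε))
    (hle : phiInv φ (1 - ε ^ 2) ≤ C ^ 2 * phiInv φ (bdryDist (OmegaPhi φ m) (zPoint l ε))) :
    AxisEstimates φ l ε C := by
  have hup := h.bdryDist_le l h1
  set δ := bdryDist (OmegaPhi φ m) (zPoint l ε) with hδ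
  have hδ1 : δ ≤ 1 := by linarith
  have hδε : δ ≤ 1 - ε ^ 2 := by nlinarith
  have hε0 : 0 < 1 - ε ^ 2 := by linarith
  have hε1 : 1 - ε ^ 2 ≤ 1 := by nlinarith
  set η := sqrtInvDelta φ l ε with hη
  have hη0 : 0 < η := Real.sqrt_pos.2 (h.phiInv_pos hpos hδ1)
  have hη2 : η ^ 2 = phiInv φ δ := Real.sq_sqrt (h.phiInv_pos hpos hδ1).le
  set R := Real.sqrt (phiInv φ (1 - ε ^ 2)) with hRdef
  have hR0 : 0 < R := Real.sqrt_pos.2 (h.phiInv_pos hε0 hε1)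
  have hR2 : R ^ 2 = phiInv φ (1 - ε ^ 2) := Real.sq_sqrt (h.phiInv_pos hε0 hε1).le
  have hφR : φ (R ^ 2) = 1 - ε ^ 2 := by rw [hR2, h.map_phiInv hε0 hε1]
  have hRC : R ≤ C * η := by
    rw [← sq_le_sq₀ hR0.le (by positivity), mul_pow, hR2, hη2]
    exact hle
  have hdisc : ∀ lam : ℂ, ‖lam‖ < 1 → zPoint l ε + ((η : ℂ) * lam) • eOne m ∈ OmegaPhi φ m := by
    intro lam hlam
    rw [mem_OmegaPhi_zPoint_add]
    refine lt_of_lt_of_le ?_ hδε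
    rw [← h.map_phiInv hpos hδ1, ← hη2]
    refine h.strictMonoOn_Ici (mem_Ici.2 (by positivity)) (mem_Ici.2 (by positivity)) ?_
    rw [norm_mul, Complex.norm_real, Real.norm_of_nonneg hη0.le]
    gcongr
    exact mul_lt_of_lt_one_right hη0 hlam
  let A : Set ℝ := {r : ℝ | 0 < r ∧ ∀ lam : ℂ, ‖lam‖ < 1 →
    zPoint l ε + ((r : ℂ) * lam) • eOne m ∈ OmegaPhi φ m}
  have hηA : η ∈ A := ⟨hη0, hdisc⟩
  have hRub : ∀ r ∈ A, r ≤ R := by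
    rintro r ⟨hr, hr'⟩
    by_contra! hlt
    -- This parameter lands on the rim of the slice, which is outside `Ω_φ`.
    have := hr' ((R / r : ℝ) : ℂ) (by
      rw [Complex.norm_real, Real.norm_of_nonneg (by positivity)]
      exact (div_lt_one hr).2 hlt)
    rw [mem_OmegaPhi_zPoint_add, ← Complex.ofReal_mul, mul_div_cancel₀ _ hr.ne',
      Complex.norm_real, Real.norm_of_nonneg hR0.le, hφR] at this
    exact lt_irrefl _ this
  refine ⟨⟨?_, ?_⟩, ?_⟩
  · exact le_csSup (s := A) ⟨R, hRub⟩ hηA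
  · exact (csSup_le (s := A) ⟨η, hηA⟩ hRub).trans hRC
  intro v hv
  obtain ⟨c, rfl⟩ := Submodule.mem_span_singleton.1 hv
  have hnorm : ‖c • eOne m‖ = ‖c‖ := by simp [norm_smul, eOne]
  rw [hnorm]
  -- The affine disc of radius `η` gives the upper bound and shows that the infimum is over a
  -- nonempty set.
  have hmem : ‖c‖ / η ∈ {t : ℝ | ∃ (α : ℂ) (f : ℂ → CSpace m), ‖α‖ = t ∧
      DifferentiableOn ℂ f (Metric.ball 0 1) ∧ MapsTo f (Metric.ball 0 1) (OmegaPhi φ m) ∧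
      f 0 = zPoint l ε ∧ α • deriv f 0 = c • eOne m} := by
    have hd : ∀ t : ℂ, HasDerivAt (fun t : ℂ => zPoint l ε + ((η : ℂ) * t) • eOne m)
        ((η : ℂ) • eOne m) t := by
      intro t
      have := (((hasDerivAt_id t).const_mul (η : ℂ)).smul_const (eOne m)).const_add (zPoint l ε)
      simpa using this
    refine ⟨c / η, fun t => zPoint l ε + ((η : ℂ) * t) • eOne m, ?_,
      fun t _ => (hd t).differentiableAt.differentiableWithinAt,
      fun t ht => hdisc t (mem_ball_zero_iff.1 ht), by simp, ?_⟩
    · rw [norm_div, Complex.norm_real, Real.norm_of_nonneg hη0.le]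
    · rw [(hd 0).deriv, smul_smul, div_mul_cancel₀ _ (Complex.ofReal_ne_zero.2 hη0.ne')]
  refine ⟨le_csInf ⟨_, hmem⟩ ?_, csInf_le ⟨0, ?_⟩ hmem⟩
  · rintro _ ⟨α, f, rfl, hf, hmaps, h0, hα⟩
    rcases eq_or_ne α 0 with rfl | hα0
    · have : c = 0 := by
        rw [zero_smul] at hα
        rw [← norm_eq_zero, ← hnorm, ← hα, norm_zero]
      simp [this]
    have hc : deriv f 0 = (α⁻¹ * c) • eOne m := by
      rw [mul_smul, ← hα, smul_smul, inv_mul_cancel₀ hα0, one_smul]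
    have hb := h.norm_deriv_apply_zero_le l hR0 hφR hf hmaps h0 hc
    rw [norm_mul, norm_inv, inv_mul_le_iff₀ (norm_pos_iff.2 hα0)] at hb
    rw [div_le_iff₀ (by positivity)]
    refine hb.trans ?_
    rw [mul_assoc 2 C η]
    gcongr
  · rintro _ ⟨α, f, rfl, -⟩
    exact norm_nonneg α

/-! ### The constants `2` and `C_φ`. -/

lemma quarter_le_bdryDist_of_or (h : IsProfile φ D k s m a) (l : Fin m) {ε : ℝ} (h1 : -1 < ε)
    (h2 : ε < -1 / 2) (ha : 1 / 4 ≤ a ∨ 1 + ε ≤ a) :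
    (1 - ε ^ 2) / 4 ≤ bdryDist (OmegaPhi φ m) (zPoint l ε) := by
  rcases le_or_gt (1 + ε) a with hle | hlt
  · have := h.one_add_le_bdryDist l h1 (by linarith) hle
    nlinarith
  · have ha4 := ha.resolve_right hlt.not_ge
    exact h.quarter_le_bdryDist l (by linarith) h2.le ha4

lemma phiInv_le_of_or (h : IsProfile φ D k s m a) (l : Fin m) {ε : ℝ} (h1 : -1 < ε)
    (h2 : ε < -1 / 2) (ha : 1 / 4 ≤ a ∨ 1 + ε ≤ a) :
    phiInv φ (1 - ε ^ 2) ≤ 2 ^ 2 * phiInv φ (bdryDist (OmegaPhi φ m) (zPoint l ε)) := by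
  have hq := h.quarter_le_bdryDist_of_or l h1 h2 ha
  have hup := h.bdryDist_le l h1
  exact h.phiInv_le_mul (by nlinarith) (by linarith) (by nlinarith) (by nlinarith) (by norm_num)
    (by linarith)

lemma bdryDist_pos (h : IsProfile φ D k s m a) (l : Fin m) {ε : ℝ} (h1 : -1 < ε)
    (h2 : ε < -1 / 2) : 0 < bdryDist (OmegaPhi φ m) (zPoint l ε) := by
  rcases le_total (1 + ε) a with ha | ha
  · linarith [h.one_add_le_bdryDist l h1 (by linarith) ha]
  · linarith [h.a_le_bdryDist l (by linarith) ha, h.a_pos]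

lemma phiInv_one (h : IsProfile φ D k s m a) : phiInv φ 1 = a :=
  h.strictMonoOn_Ici.injOn (h.phiInv_pos one_pos le_rfl).le h.a_pos.le
    ((h.map_phiInv one_pos le_rfl).trans h.phi_a.symm)

lemma phiInv_le_max (h : IsProfile φ D k s m a) (l : Fin m) {ε : ℝ} (h1 : -1 < ε)
    (h2 : ε < -1 / 2) :
    phiInv φ (1 - ε ^ 2) ≤ max 2 (Real.sqrt (a / phiInv φ a)) ^ 2 *
      phiInv φ (bdryDist (OmegaPhi φ m) (zPoint l ε)) := by
  have hpos := h.bdryDist_pos l h1 h2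
  have hup := h.bdryDist_le l h1
  have hinv := h.phiInv_pos hpos (by linarith)
  rcases le_total (1 + ε) a with ha | ha
  · refine (h.phiInv_le_of_or l h1 h2 (Or.inr ha)).trans ?_
    gcongr
    exact le_max_left _ _
  · have ha0 := h.a_pos
    have hpa := h.phiInv_pos ha0 (by linarith)
    -- Here `d ≥ a`, so the ratio is at most `φ⁻¹(1) / φ⁻¹(a) = a / φ⁻¹(a)`.
    calc phiInv φ (1 - ε ^ 2) ≤ phiInv φ 1 :=
          h.phiInv_mono (by nlinarith) (by nlinarith) le_rfl
      _ = a / phiInv φ a * phiInv φ a := by rw [h.phiInv_one, div_mul_cancel₀ _ hpa.ne']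
      _ = Real.sqrt (a / phiInv φ a) ^ 2 * phiInv φ a := by rw [Real.sq_sqrt (by positivity)]
      _ ≤ _ := by
        gcongr
        · exact le_max_right _ _
        · exact h.phiInv_mono ha0 (h.a_le_bdryDist l (by linarith) ha) (by linarith)

end IsProfile

theorem propositionP (φ : ℝ → ℝ) (D : ℕ → ℝ) (k s m : ℕ) (a : ℝ)
    (h : IsProfile φ D k s m a) :
    IsBRegularDomain (OmegaPhi φ m) ∧
    ∀ (l : Fin m) (ε : ℝ), -1 < ε → ε < -1 / 2 →
      ((1 / 4 ≤ a ∨ 1 + ε ≤ a) → AxisEstimates φ l ε 2) ∧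
      AxisEstimates φ l ε (max 2 (Real.sqrt (a / phiInv φ a))) := by
  refine ⟨h.isBRegularDomain, fun l ε h1 h2 => ⟨fun ha => ?_, ?_⟩⟩
  · exact h.axisEstimates_of_phiInv_le l h1 h2 two_pos (h.bdryDist_pos l h1 h2)
      (h.phiInv_le_of_or l h1 h2 ha)
  · exact h.axisEstimates_of_phiInv_le l h1 h2 (two_pos.trans_le (le_max_left _ _))
      (h.bdryDist_pos l h1 h2) (h.phiInv_le_max l h1 h2)
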